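/- Let $n$ be a number of oscillator modes with Hilbert space $L^2(\mathbb R^n)$, annihilation and creation operators $\hat a_j=(x_j+\partial_j)/\sqrt2$, $\hat a_j^\dagger=(x_j-\partial_j)/\sqrt2$, and displacement operators $D(\xi)=\exp\big[\sum_j(\xi_j\hat a_j^\dagger-\xi_j^*\hat a_j)\big]$, $\xi\in\mathbb C^n$. Let $\hat\rho$ be any density operator (positive, of trace one) on this space, let $-1\le s\le 1$, and let $$\chi_{\hat\rho}(\xi;s)=\exp\Big[\frac s2\sum_j|\xi_j|^2\Big]\,\mathrm{Tr}\big(\hat\rho\,D(\xi)\big)$$ be the characteristic function of the $s$-ordered quasi-probability of $\hat\rho$. Then the cumulant generating function $\Gamma=\log\chi_{\hat\rho}(\cdot\,;s)$ is not a polynomial of finite degree greater than $2$: there is no polynomial $P$ with complex coefficients, of total degree greater than $2$ in the $2n$ real variables $\mathrm{Re}\,\xi_j,\mathrm{Im}\,\xi_j$, such that $\chi_{\hat\rho}(\xi;s)=\exp P(\xi)$ for all $\xi$ in some neighbourhood of $0$ (in particular, none such that this holds for all $\xi\in\mathbb C^n$). -/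

import Mathlib

open MeasureTheory Filter Topology
open scoped ENNReal ComplexConjugate InnerProductSpace

/-- The Hilbert space `L²(ℝⁿ)` of `n` oscillator modes (Schrödinger representation). -/
abbrev ModeSpace (n : ℕ) : Type := Lp ℂ 2 (volume : Measure (Fin n → ℝ))

/-! ### Ladder operators and displacement operators -/

/-- The partial derivative `∂ψ/∂x_j` of a wave function at `x`. -/
noncomputable def partialDeriv {n : ℕ} (j : Fin n) (ψ : (Fin n → ℝ) → ℂ) (x : Fin n → ℝ) : ℂ :=
  fderiv ℝ ψ x (Pi.single j 1)

/-- The annihilation operator `a_j = (x_j + ∂_j) / √2`, as a differential operator. -/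
noncomputable def annihilation {n : ℕ} (j : Fin n) (ψ : (Fin n → ℝ) → ℂ) (x : Fin n → ℝ) : ℂ :=
  ((x j : ℂ) * ψ x + partialDeriv j ψ x) / (√2 : ℝ)

/-- The creation operator `a_j† = (x_j - ∂_j) / √2`, as a differential operator. -/
noncomputable def creation {n : ℕ} (j : Fin n) (ψ : (Fin n → ℝ) → ℂ) (x : Fin n → ℝ) : ℂ :=
  ((x j : ℂ) * ψ x - partialDeriv j ψ x) / (√2 : ℝ)

/-- The position shift `q = √2 Re ξ` produced by a displacement `ξ = (q + i p) / √2`. -/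
noncomputable def positionShift {n : ℕ} (ξ : Fin n → ℂ) : Fin n → ℝ := fun j => √2 * (ξ j).re

/-- The momentum shift `p = √2 Im ξ` produced by a displacement `ξ = (q + i p) / √2`. -/
noncomputable def momentumShift {n : ℕ} (ξ : Fin n → ℂ) : Fin n → ℝ := fun j => √2 * (ξ j).im

/-- The phase factor `exp(i p·x - i p·q / 2)`. -/
noncomputable def displacementPhase {n : ℕ} (ξ : Fin n → ℂ) (x : Fin n → ℝ) : ℂ :=
  Complex.exp (((∑ j, momentumShift ξ j * (x j - positionShift ξ j / 2) : ℝ) : ℂ) * Complex.I)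

/-- The displacement `exp(∑ⱼ (ξⱼ aⱼ† - ξⱼ* aⱼ)) = exp(i p·x - q·∇)` on wave functions:
`(D(ξ) ψ)(x) = exp(i p·x - i p·q / 2) ψ(x - q)`, where `ξ = (q + i p) / √2`.
That this is the exponential is the content of `displaceFun_zero` and `hasDerivAt_displaceFun`. -/
noncomputable def displaceFun {n : ℕ} (ξ : Fin n → ℂ) (ψ : (Fin n → ℝ) → ℂ) :
    (Fin n → ℝ) → ℂ :=
  fun x => displacementPhase ξ x * ψ (x - positionShift ξ)

theorem displaceFun_zero {n : ℕ} (ψ : (Fin n → ℝ) → ℂ) : displaceFun 0 ψ = ψ := by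
  funext x
  have h : positionShift (0 : Fin n → ℂ) = 0 := by funext j; simp [positionShift]
  simp [displaceFun, displacementPhase, momentumShift, h]

/-- On differentiable wave functions, `u(t) = D(t ξ) ψ` solves
`du/dt = ∑ⱼ (ξⱼ aⱼ† - ξⱼ* aⱼ) u`. -/
theorem hasDerivAt_displaceFun {n : ℕ} (ξ : Fin n → ℂ) (ψ : (Fin n → ℝ) → ℂ)
    (hψ : Differentiable ℝ ψ) (x : Fin n → ℝ) (t : ℝ) :
    HasDerivAt (fun t : ℝ => displaceFun (t • ξ) ψ x)
      (∑ j, (ξ j * creation j (displaceFun (t • ξ) ψ) x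
        - conj (ξ j) * annihilation j (displaceFun (t • ξ) ψ) x)) t := by
  have hs : ∀ r : ℝ, positionShift (r • ξ) = r • positionShift ξ := fun r => by
    funext j; simp [positionShift]; ring
  have hm : ∀ (r : ℝ) j, momentumShift (r • ξ) j = r * momentumShift ξ j := fun r j => by
    simp [momentumShift]; ring
  set q := positionShift ξ with hq
  set p := momentumShift ξ with hp
  have hψ' := (hψ (x - t • q)).hasFDerivAt
  -- the derivative in time
  have h1 : HasDerivAt (fun r : ℝ => ψ (x - r • q)) (fderiv ℝ ψ (x - t • q) (-q)) t := by
    have h : HasDerivAt (fun r : ℝ => x - r • q) (-q) t := by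
      simpa using ((hasDerivAt_id t).smul_const q).const_sub x
    exact hψ'.comp_hasDerivAt t h
  have h2 : HasDerivAt (fun r : ℝ => ∑ j, r * p j * (x j - r * q j / 2))
      (∑ j, p j * (x j - t * q j)) t := by
    refine HasDerivAt.fun_sum fun j _ => ?_
    have := ((hasDerivAt_id t).mul_const (p j)).mul
      ((((hasDerivAt_id t).mul_const (q j)).div_const 2).const_sub (x j))
    refine this.congr_deriv ?_
    simp only [id]; ring
  have h3 := ((h2.ofReal_comp.mul_const Complex.I).cexp).mul h1
  have e1 : (fun r : ℝ => displaceFun (r • ξ) ψ x) =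
      fun r : ℝ => Complex.exp (((∑ j, r * p j * (x j - r * q j / 2) : ℝ) : ℂ) * Complex.I)
        * ψ (x - r • q) := by
    funext r
    simp only [displaceFun, displacementPhase, hs, hm, Pi.smul_apply, smul_eq_mul]
  rw [e1]
  refine h3.congr_deriv ?_
  -- the spatial derivatives
  have h4 : ∀ j, partialDeriv j (displaceFun (t • ξ) ψ) x =
      Complex.exp (((∑ j, t * p j * (x j - t * q j / 2) : ℝ) : ℂ) * Complex.I)
        * (((t * p j : ℝ) : ℂ) * Complex.I * ψ (x - t • q)
          + fderiv ℝ ψ (x - t • q) (Pi.single j 1)) := by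
    intro j
    have hd : HasDerivAt (fun r : ℝ => displaceFun (t • ξ) ψ (x + r • Pi.single j 1))
        (partialDeriv j (displaceFun (t • ξ) ψ) x) 0 := by
      have hdiff : Differentiable ℝ (displaceFun (t • ξ) ψ) := by
        unfold displaceFun displacementPhase
        fun_prop
      have h : HasDerivAt (fun r : ℝ => x + r • (Pi.single j 1 : Fin n → ℝ)) (Pi.single j 1) 0 := by
        simpa using ((hasDerivAt_id (0 : ℝ)).smul_const (Pi.single j 1 : Fin n → ℝ)).const_add x
      have h' := (hdiff (x + (0 : ℝ) • (Pi.single j 1 : Fin n → ℝ))).hasFDerivAt.comp_hasDerivAt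
        (0 : ℝ) h
      simpa [partialDeriv, Function.comp_def] using h'
    refine hd.unique ?_
    have g1 : HasDerivAt (fun r : ℝ => ψ (x + r • (Pi.single j 1 : Fin n → ℝ) - t • q))
        (fderiv ℝ ψ (x - t • q) (Pi.single j 1)) 0 := by
      have h : HasDerivAt (fun r : ℝ => x + r • (Pi.single j 1 : Fin n → ℝ) - t • q)
          (Pi.single j 1) 0 := by
        simpa using (((hasDerivAt_id (0 : ℝ)).smul_const
          (Pi.single j 1 : Fin n → ℝ)).const_add x).sub_const (t • q)
      have h' := (hψ (x + (0 : ℝ) • (Pi.single j 1 : Fin n → ℝ) - t • q)).hasFDerivAt.comp_hasDerivAt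
        (0 : ℝ) h
      simpa [Function.comp_def] using h'
    have g2 : HasDerivAt (fun r : ℝ => ∑ k, t * p k *
        ((x + r • (Pi.single j 1 : Fin n → ℝ)) k - t * q k / 2)) (t * p j) 0 := by
      have h : HasDerivAt (fun r : ℝ => r * (t * p j) + ∑ k, t * p k * (x k - t * q k / 2))
          (t * p j) 0 := by
        simpa using ((hasDerivAt_id (0 : ℝ)).mul_const (t * p j)).add_const
          (∑ k, t * p k * (x k - t * q k / 2))
      refine h.congr_of_eventuallyEq (Eventually.of_forall fun r => ?_)
      have e : ∀ k, t * p k * ((x + r • (Pi.single j 1 : Fin n → ℝ)) k - t * q k / 2)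
          = r * (t * p k) * (Pi.single j 1 : Fin n → ℝ) k + t * p k * (x k - t * q k / 2) := by
        intro k; simp only [Pi.add_apply, Pi.smul_apply, smul_eq_mul]; ring
      simp only [e, Finset.sum_add_distrib]
      simp [Pi.single_apply]
    have g3 := ((g2.ofReal_comp.mul_const Complex.I).cexp).mul g1
    have e2 : (fun r : ℝ => displaceFun (t • ξ) ψ (x + r • Pi.single j 1)) =
        fun r : ℝ => Complex.exp (((∑ k, t * p k *
          ((x + r • (Pi.single j 1 : Fin n → ℝ)) k - t * q k / 2) : ℝ) : ℂ) * Complex.I)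
          * ψ (x + r • (Pi.single j 1 : Fin n → ℝ) - t • q) := by
      funext r
      simp only [displaceFun, displacementPhase, hs, hm, Pi.smul_apply, smul_eq_mul]
    rw [e2]
    refine g3.congr_deriv ?_
    simp only [zero_smul, add_zero]
    ring
  -- comparison
  have h5 : fderiv ℝ ψ (x - t • q) (-q) =
      ∑ j, -((q j : ℂ) * fderiv ℝ ψ (x - t • q) (Pi.single j 1)) := by
    conv_lhs => rw [map_neg, pi_eq_sum_univ' q, map_sum, ← Finset.sum_neg_distrib]
    refine Finset.sum_congr rfl fun j _ => ?_
    rw [map_smul, Complex.real_smul]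
    congr 4
    funext k
    simp [Pi.single_apply]
  have h6 : displaceFun (t • ξ) ψ x =
      Complex.exp (((∑ j, t * p j * (x j - t * q j / 2) : ℝ) : ℂ) * Complex.I)
        * ψ (x - t • q) := congrFun e1 t
  have h7 : ((√2 : ℝ) : ℂ) * ((√2 : ℝ) : ℂ) = 2 := by
    rw [← Complex.ofReal_mul, Real.mul_self_sqrt (by norm_num)]; simp
  have h8 : ((√2 : ℝ) : ℂ) ≠ 0 := by
    intro h; rw [h] at h7; norm_num at h7
  have h9 : ∀ (j : Fin n) (u v : ℂ), ξ j * ((x j * u - v) / (√2 : ℝ))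
      - conj (ξ j) * ((x j * u + v) / (√2 : ℝ)) = p j * Complex.I * x j * u - q j * v := by
    intro j u v
    have hx : ξ j = (ξ j).re + (ξ j).im * Complex.I := (Complex.re_add_im _).symm
    have hc : conj (ξ j) = (ξ j).re - (ξ j).im * Complex.I := by
      apply Complex.ext <;> simp
    simp only [hp, hq, momentumShift, positionShift, Complex.ofReal_mul]
    rw [hc]
    nth_rewrite 1 [hx]
    field_simp
    linear_combination (-(ξ j).im * Complex.I * x j * u + (ξ j).re * v) * h7
  simp only [creation, annihilation, h9, h4, h6, h5]
  generalize Complex.exp (((∑ j, t * p j * (x j - t * q j / 2) : ℝ) : ℂ) * Complex.I) = c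
  rw [Finset.mul_sum, Complex.ofReal_sum, Finset.sum_mul, Finset.mul_sum, Finset.sum_mul,
    ← Finset.sum_add_distrib]
  refine Finset.sum_congr rfl fun j _ => ?_
  push_cast
  ring

theorem norm_displacementPhase {n : ℕ} (ξ : Fin n → ℂ) (x : Fin n → ℝ) :
    ‖displacementPhase ξ x‖ = 1 := Complex.norm_exp_ofReal_mul_I _

theorem continuous_displacementPhase {n : ℕ} (ξ : Fin n → ℂ) :
    Continuous (displacementPhase ξ) := by
  unfold displacementPhase; fun_prop

theorem displaceFun_congr {n : ℕ} (ξ : Fin n → ℂ) {ψ φ : (Fin n → ℝ) → ℂ}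
    (h : ψ =ᵐ[volume] φ) : displaceFun ξ ψ =ᵐ[volume] displaceFun ξ φ := by
  have := (measurePreserving_sub_right (volume : Measure (Fin n → ℝ))
    (positionShift ξ)).quasiMeasurePreserving.ae_eq_comp h
  filter_upwards [this] with x hx
  simp only [Function.comp_apply] at hx
  simp [displaceFun, hx]

theorem eLpNorm_displaceFun {n : ℕ} (ξ : Fin n → ℂ) {ψ : (Fin n → ℝ) → ℂ}
    (h : AEStronglyMeasurable ψ volume) :
    eLpNorm (displaceFun ξ ψ) 2 volume = eLpNorm ψ 2 volume := by
  rw [← eLpNorm_comp_measurePreserving h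
    (measurePreserving_sub_right (volume : Measure (Fin n → ℝ)) (positionShift ξ))]
  refine eLpNorm_congr_norm_ae (Eventually.of_forall fun x => ?_)
  simp [displaceFun, norm_displacementPhase]

theorem memLp_displaceFun {n : ℕ} (ξ : Fin n → ℂ) {ψ : (Fin n → ℝ) → ℂ}
    (h : MemLp ψ 2 volume) : MemLp (displaceFun ξ ψ) 2 volume := by
  refine ⟨?_, ?_⟩
  · exact (continuous_displacementPhase ξ).aestronglyMeasurable.mul
      (h.1.comp_measurePreserving
        (measurePreserving_sub_right (volume : Measure (Fin n → ℝ)) (positionShift ξ)))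
  · rw [eLpNorm_displaceFun ξ h.1]; exact h.2

/-- The displacement operator `D(ξ)` as a linear isometry of the Hilbert space. -/
noncomputable def displacementIsometry {n : ℕ} (ξ : Fin n → ℂ) :
    ModeSpace n →ₗᵢ[ℂ] ModeSpace n where
  toFun ψ := (memLp_displaceFun ξ (Lp.memLp ψ)).toLp (displaceFun ξ ψ)
  map_add' ψ φ := by
    rw [← MemLp.toLp_add]
    refine MemLp.toLp_congr _ _ ((displaceFun_congr ξ (Lp.coeFn_add ψ φ)).trans ?_)
    exact Eventually.of_forall fun x => by simp [displaceFun, mul_add]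
  map_smul' c ψ := by
    rw [RingHom.id_apply, ← MemLp.toLp_const_smul]
    refine MemLp.toLp_congr _ _ ((displaceFun_congr ξ (Lp.coeFn_smul c ψ)).trans ?_)
    exact Eventually.of_forall fun x => by simp [displaceFun, mul_left_comm]
  norm_map' ψ := by
    change ‖(memLp_displaceFun ξ (Lp.memLp ψ)).toLp (displaceFun ξ ψ)‖ = ‖ψ‖
    rw [Lp.norm_toLp, eLpNorm_displaceFun ξ (Lp.aestronglyMeasurable ψ), Lp.norm_def]

/-- The `n`-mode displacement operator `D(ξ) = exp(∑ⱼ (ξⱼ aⱼ† - ξⱼ* aⱼ))`. -/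
noncomputable def displacement {n : ℕ} (ξ : Fin n → ℂ) : ModeSpace n →L[ℂ] ModeSpace n :=
  (displacementIsometry ξ).toContinuousLinearMap

/-! ### States and their `s`-ordered characteristic functions -/

/-- The trace of an operator, computed in an orthonormal basis `b` of the Hilbert space
(for trace-class operators it does not depend on `b`). -/
noncomputable def operatorTrace {E : Type*} [NormedAddCommGroup E] [InnerProductSpace ℂ E]
    {ι : Type*} (b : HilbertBasis ι ℂ E) (T : E →L[ℂ] E) : ℂ :=
  ∑' i, ⟪b i, T (b i)⟫_ℂ

/-- Density operators: positive operators of trace one. -/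
structure IsDensityOperator {E : Type*} [NormedAddCommGroup E] [InnerProductSpace ℂ E]
    {ι : Type*} (b : HilbertBasis ι ℂ E) (ρ : E →L[ℂ] E) : Prop where
  isPositive : ρ.IsPositive
  summable : Summable fun i => ⟪b i, ρ (b i)⟫_ℂ
  trace_eq_one : operatorTrace b ρ = 1

/-- The characteristic function `χ_ρ(ξ; s) = exp((s / 2) |ξ|²) Tr(ρ D(ξ))` of the `s`-ordered
quasi-probability of `ρ`. -/
noncomputable def quasiCharFun {n : ℕ} {ι : Type*} (b : HilbertBasis ι ℂ (ModeSpace n))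
    (ρ : ModeSpace n →L[ℂ] ModeSpace n) (s : ℝ) (ξ : Fin n → ℂ) : ℂ :=
  Complex.exp ((s / 2 * ∑ j, ‖ξ j‖ ^ 2 : ℝ) : ℂ) * operatorTrace b (ρ ∘L displacement ξ)

/-! ### Cumulant generating functions -/

/-- `Γ` is a cumulant generating function on `U` for the characteristic function `χ`, that is,
`Γ = log χ` on `U` for some choice of the logarithm at each point: `χ = exp Γ` on `U`. -/
def IsCumulantGeneratingFunctionOn {n : ℕ} (U : Set (Fin n → ℂ)) (χ Γ : (Fin n → ℂ) → ℂ) : Prop :=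
  ∀ ξ ∈ U, Complex.exp (Γ ξ) = χ ξ

/-- The function on `ℂⁿ = ℝ²ⁿ` given by a polynomial with complex coefficients in the `2n` real
variables `Re ξ₁, …, Re ξₙ, Im ξ₁, …, Im ξₙ`. -/
noncomputable def phasePolynomial {n : ℕ} (P : MvPolynomial (Fin n ⊕ Fin n) ℂ)
    (ξ : Fin n → ℂ) : ℂ :=
  MvPolynomial.eval (Sum.elim (fun j => ((ξ j).re : ℂ)) (fun j => ((ξ j).im : ℂ))) P

/-! ### Finite differences and derivatives -/

/-! This is a local version of Marcinkiewicz's theorem, reached through positive definiteness.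
Suppose `χ = exp P` near `0` with `deg P = d > 2`, and restrict to a real line `t ↦ t • ξ` on which
the top homogeneous part of `P` does not vanish. The factor `exp (s|ξ|²/2)` alters only the
quadratic coefficient, so `Tr (ρ D(tξ)) = exp (p t)` for small real `t`, with `p` still of degree
`d`. Since `t ↦ D(tξ)` is a one-parameter group of isometries, this trace is positive definite in
`t` (`operatorTrace_posDef`).

The entire function `F = exp ∘ p` is thus known to be positive definite only near `0`, but that is
enough. Finite differences turn it into positivity of the Hankel form of the derivatives of `F` at
`0` (`hankel_nonneg`), and Taylor expansion turns this into positivity of the kernel `F (z - conj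
w)` on all of `ℂ` (`kernel_nonneg_of_hankel_nonneg`). Its 2 × 2 minors give the ridge inequality `|F
(y + ix)| ≤ |F (ix)|`, that is `Re p (y + ix) ≤ Re p (ix)`. Comparing leading terms at infinity,
`not_re_le_of_three_le_degree` excludes this for `d ≥ 3`. -/

theorem hasDerivAt_fwdDiff_iter {G G' : ℂ → ℂ} (hG : ∀ x, HasDerivAt G (G' x) x) (h : ℂ) (n : ℕ) :
    ∀ x, HasDerivAt ((fwdDiff h)^[n] G) ((fwdDiff h)^[n] G' x) x := by
  induction n generalizing G G' with
  | zero => exact hG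
  | succ n ih =>
    refine ih (G := fwdDiff h G) (G' := fwdDiff h G') fun x => ?_
    exact ((hG (x + h)).comp_add_const x h).sub (hG x)

/-- Near the origin, the `n`-th finite difference of an entire function with step `h` is
`hⁿ` times the `n`-th derivative at the origin, up to `o(hⁿ)`. -/
theorem norm_fwdDiff_iter_sub_le (n : ℕ) {G : ℂ → ℂ} (hG : Differentiable ℂ G) {ε : ℝ}
    (hε : 0 < ε) : ∃ δ > 0, ∀ h x : ℂ, ‖h‖ < δ → ‖x‖ < δ →
      ‖(fwdDiff h)^[n] G x - h ^ n * iteratedDeriv n G 0‖ ≤ ε * ‖h‖ ^ n := by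
  induction n generalizing G with
  | zero =>
    obtain ⟨δ, hδ, H⟩ := Metric.continuous_iff.1 hG.continuous 0 ε hε
    refine ⟨δ, hδ, fun h x _ hx => ?_⟩
    simpa [dist_eq_norm] using (H x (by simpa using hx)).le
  | succ n ih =>
    have hG' : Differentiable ℂ (deriv G) := hG.deriv
    obtain ⟨δ, hδ, H⟩ := ih hG'
    -- Half the radius keeps both `x` and `x + h` in the ball of radius `δ`.
    refine ⟨δ / 2, by positivity, fun h x hh hx => ?_⟩
    set c := iteratedDeriv (n + 1) G 0 with hc
    have hc' : iteratedDeriv n (deriv G) 0 = c := by rw [hc, iteratedDeriv_succ']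
    have hd : ∀ y ∈ Metric.ball (0 : ℂ) δ, HasDerivWithinAt
        (fun y => (fwdDiff h)^[n] G y - y * (h ^ n * c))
        ((fwdDiff h)^[n] (deriv G) y - h ^ n * c) (Metric.ball 0 δ) y := fun y _ => by
      have h1 := hasDerivAt_fwdDiff_iter (fun x => (hG x).hasDerivAt) h n y
      simpa using (h1.fun_sub ((hasDerivAt_id y).mul_const (h ^ n * c))).hasDerivWithinAt
    have hb : ∀ y ∈ Metric.ball (0 : ℂ) δ,
        ‖(fwdDiff h)^[n] (deriv G) y - h ^ n * c‖ ≤ ε * ‖h‖ ^ n := fun y hy => by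
      rw [← hc']
      exact H h y (by linarith) (by simpa using hy)
    -- Mean value inequality for the `n`-th difference minus its expected linear part; the induction
    -- hypothesis for `deriv G` bounds the derivative.
    have key := (convex_ball (0 : ℂ) δ).norm_image_sub_le_of_norm_hasDerivWithin_le hd hb
      (x := x) (y := x + h) (by simp; linarith)
      (by simpa using (norm_add_le x h).trans_lt (by linarith))
    rw [Function.iterate_succ_apply', fwdDiff]
    calc _ = ‖(fwdDiff h)^[n] G (x + h) - (x + h) * (h ^ n * c)
          - ((fwdDiff h)^[n] G x - x * (h ^ n * c))‖ := by congr 1; ring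
      _ ≤ _ := key
      _ = _ := by rw [add_sub_cancel_left]; ring

theorem fwdDiff_neg_iter (h : ℂ) (k : ℕ) (G : ℂ → ℂ) :
    (fwdDiff (-h))^[k] G = fun x => (-1) ^ k * (fwdDiff h)^[k] G (x - k * h) := by
  induction k with
  | zero => simp
  | succ k ih =>
    funext x
    rw [Function.iterate_succ_apply', ih, Function.iterate_succ_apply']
    simp only [fwdDiff]
    have e1 : x + -h - k * h = x - (k + 1 : ℕ) * h := by push_cast; ring
    have e2 : x - (k + 1 : ℕ) * h + h = x - k * h := by push_cast; ring
    rw [e1, e2]; ring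

/-- For a kernel `F (t - s)`, a step `h` in `s` is a step `-h` in the argument of `F`. Each backward
step is a negated forward step from a point shifted by `-h`, whence the sign and the base point `x -
k * h`. -/
theorem fwdDiff_fwdDiff_neg_iter (h : ℂ) (j k : ℕ) (G : ℂ → ℂ) (x : ℂ) :
    (fwdDiff h)^[j] ((fwdDiff (-h))^[k] G) x
      = (-1) ^ k * (fwdDiff h)^[j + k] G (x - k * h) := by
  rw [fwdDiff_neg_iter, Function.iterate_add_apply]
  have e : (fun x => (-1) ^ k * (fwdDiff h)^[k] G (x - k * h))
      = (-1 : ℂ) ^ k • fun x => (fwdDiff h)^[k] G (x + -(k * h)) := by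
    funext x; simp [sub_eq_add_neg]
  rw [e, fwdDiff_iter_const_smul]
  simp only [Pi.smul_apply, smul_eq_mul, fwdDiff_iter_comp_add, sub_eq_add_neg]

theorem tendsto_fwdDiff_fwdDiff_neg_iter {G : ℂ → ℂ} (hG : Differentiable ℂ G) (j k : ℕ) :
    Tendsto (fun h : ℝ => (fwdDiff (h : ℂ))^[j] ((fwdDiff (-(h : ℂ)))^[k] G) 0 / (h : ℂ) ^ (j + k))
      (𝓝[>] 0) (𝓝 ((-1) ^ k * iteratedDeriv (j + k) G 0)) := by
  rw [Metric.tendsto_nhds]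
  intro ε hε
  obtain ⟨δ, hδ, H⟩ := norm_fwdDiff_iter_sub_le (j + k) hG (half_pos hε)
  have hk : (0 : ℝ) < k + 1 := by positivity
  -- The divisor `k + 1` keeps both the step `h` and the base point `-k * h` within `δ`.
  filter_upwards [Ioo_mem_nhdsGT (show (0 : ℝ) < δ / (k + 1) by positivity)] with h hh
  have h0 : (h : ℂ) ≠ 0 := by exact_mod_cast hh.1.ne'
  have h1 : (k + 1) * h < δ := by
    have := (lt_div_iff₀ hk).1 hh.2; linarith
  have hn : ‖(h : ℂ)‖ = h := by rw [Complex.norm_real, Real.norm_of_nonneg hh.1.le]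
  have hkh : 0 ≤ k * h := mul_nonneg (Nat.cast_nonneg k) hh.1.le
  have hh0 := hh.1
  have := H h (0 - k * h) (by rw [hn]; nlinarith) (by
    rw [zero_sub, norm_neg, norm_mul, hn, Complex.norm_natCast]; nlinarith)
  rw [fwdDiff_fwdDiff_neg_iter, dist_eq_norm]
  have hp : (0 : ℝ) < h ^ (j + k) := by positivity
  have e : (-1) ^ k * (fwdDiff (h : ℂ))^[j + k] G (0 - k * h) / (h : ℂ) ^ (j + k)
      - (-1) ^ k * iteratedDeriv (j + k) G 0
      = (-1) ^ k * (((fwdDiff (h : ℂ))^[j + k] G (0 - k * h)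
        - h ^ (j + k) * iteratedDeriv (j + k) G 0) / h ^ (j + k)) := by
    field_simp
  rw [e, norm_mul, norm_pow, norm_neg, norm_one, one_pow, one_mul, norm_div, norm_pow, hn,
    div_lt_iff₀ hp]
  rw [hn] at this
  nlinarith

/-- One summation range serves all orders `j < N`: for `l > j` the binomial coefficient vanishes, so
the truncated exponent `j - l` does no harm. -/
theorem fwdDiff_iter_apply_zero (G : ℂ → ℂ) (h : ℂ) {j N : ℕ} (hj : j < N) :
    (fwdDiff h)^[j] G 0 =
      ∑ l ∈ Finset.range N, ((-1) ^ (j - l) * (j.choose l : ℂ)) * G (l * h) := by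
  rw [fwdDiff_iter_eq_sum_shift]
  rw [← Finset.sum_subset (Finset.range_mono (Nat.succ_le_of_lt hj))]
  · refine Finset.sum_congr rfl fun l _ => ?_
    simp
  · intro l _ hl
    rw [Nat.choose_eq_zero_of_lt (by simpa [Nat.lt_succ_iff] using hl)]
    simp

theorem sum_sum_sum_sum_comm {α M : Type*} [AddCommMonoid M] (s : Finset α)
    (f : α → α → α → α → M) :
    ∑ l ∈ s, ∑ m ∈ s, ∑ j ∈ s, ∑ k ∈ s, f l m j k
      = ∑ j ∈ s, ∑ k ∈ s, ∑ l ∈ s, ∑ m ∈ s, f l m j k := by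
  have e := fun g : α → α → M => (Finset.sum_product' s s g).symm
  simp_rw [e]
  exact Finset.sum_comm

open scoped ComplexOrder in
/-- If `F` is positive definite on real points near the origin, then its derivatives at the
origin form a positive Hankel form. -/
theorem hankel_nonneg {F : ℂ → ℂ} (hF : Differentiable ℂ F) {δ : ℝ} (hδ : 0 < δ)
    (hpos : ∀ (N : ℕ) (c : ℕ → ℂ) (t : ℕ → ℝ), (∀ l < N, |t l| < δ) →
      0 ≤ ∑ l ∈ Finset.range N, ∑ m ∈ Finset.range N,
        c l * conj (c m) * F (t l - t m)) (N : ℕ) (a : ℕ → ℂ) :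
    0 ≤ ∑ j ∈ Finset.range N, ∑ k ∈ Finset.range N,
      a j * conj (a k) * ((-1) ^ k * iteratedDeriv (j + k) F 0) := by
  have hlim : Tendsto (fun h : ℝ => ∑ j ∈ Finset.range N, ∑ k ∈ Finset.range N,
      a j * conj (a k) *
        ((fwdDiff (h : ℂ))^[j] ((fwdDiff (-(h : ℂ)))^[k] F) 0 / (h : ℂ) ^ (j + k))) (𝓝[>] 0)
      (𝓝 (∑ j ∈ Finset.range N, ∑ k ∈ Finset.range N,
      a j * conj (a k) * ((-1) ^ k * iteratedDeriv (j + k) F 0))) := by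
    exact tendsto_finsetSum _ fun j _ => tendsto_finsetSum _ fun k _ =>
      (tendsto_fwdDiff_fwdDiff_neg_iter hF j k).const_mul _
  refine ge_of_tendsto hlim ?_
  filter_upwards [Ioo_mem_nhdsGT (show (0 : ℝ) < δ / (N + 1) by positivity)] with h hh
  have hN : (0 : ℝ) < N + 1 := by positivity
  have h1 : (N + 1) * h < δ := by
    have := (lt_div_iff₀ hN).1 hh.2; linarith
  have hh0 := hh.1
  set w : ℕ → ℕ → ℂ := fun j l => (-1) ^ (j - l) * (j.choose l : ℂ) with hw
  have hwc : ∀ j l, conj (w j l) = w j l := fun j l => by simp [hw]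
  -- Test positivity on the grid `l * h` with the weights of the difference operator `∑ j, a j * h⁻ʲ
  -- * Δʲ`; the resulting form is the one whose limit is taken in `hlim`.
  have hp := hpos N (fun l => ∑ j ∈ Finset.range N, a j / (h : ℂ) ^ j * w j l)
    (fun l => l * h) (fun l hl => by
      have : (l : ℝ) < N := by exact_mod_cast hl
      rw [abs_of_nonneg (by positivity)]; nlinarith)
  refine hp.trans_eq ?_
  have e : ∀ j < N, ∀ k < N, (fwdDiff (h : ℂ))^[j] ((fwdDiff (-(h : ℂ)))^[k] F) 0 =
      ∑ l ∈ Finset.range N, ∑ m ∈ Finset.range N,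
        w j l * w k m * F ((l * h : ℝ) - (m * h : ℝ)) := by
    intro j hj k hk
    rw [fwdDiff_iter_apply_zero _ _ hj]
    refine Finset.sum_congr rfl fun l _ => ?_
    have e1 : (fwdDiff (-(h : ℂ)))^[k] F (l * h)
        = (fwdDiff (-(h : ℂ)))^[k] (fun x => F (x + l * h)) 0 := by
      rw [fwdDiff_iter_comp_add, zero_add]
    rw [e1, fwdDiff_iter_apply_zero _ _ hk, Finset.mul_sum]
    refine Finset.sum_congr rfl fun m _ => ?_
    rw [← mul_assoc]
    congr 2
    push_cast; ring
  calc _ = ∑ l ∈ Finset.range N, ∑ m ∈ Finset.range N, ∑ j ∈ Finset.range N,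
        ∑ k ∈ Finset.range N, (a j / (h : ℂ) ^ j) * (conj (a k) / (h : ℂ) ^ k) *
          (w j l * w k m * F ((l * h : ℝ) - (m * h : ℝ))) := by
        refine Finset.sum_congr rfl fun l _ => Finset.sum_congr rfl fun m _ => ?_
        simp only [map_sum, map_mul, map_div₀, map_pow, Complex.conj_ofReal, hwc]
        rw [Finset.sum_mul_sum, Finset.sum_mul]
        refine Finset.sum_congr rfl fun j _ => ?_
        rw [Finset.sum_mul]
        refine Finset.sum_congr rfl fun k _ => ?_
        ring
    _ = ∑ j ∈ Finset.range N, ∑ k ∈ Finset.range N, ∑ l ∈ Finset.range N,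
        ∑ m ∈ Finset.range N, (a j / (h : ℂ) ^ j) * (conj (a k) / (h : ℂ) ^ k) *
          (w j l * w k m * F ((l * h : ℝ) - (m * h : ℝ))) := by
        exact sum_sum_sum_sum_comm _ _
    _ = _ := by
        refine Finset.sum_congr rfl fun j hj => Finset.sum_congr rfl fun k hk => ?_
        rw [e j (Finset.mem_range.1 hj) k (Finset.mem_range.1 hk)]
        simp only [← Finset.mul_sum]
        rw [pow_add]
        have s : ∀ A B S p q : ℂ, A / p * (B / q) * S = A * B * (S / (p * q)) := by
          intros; ring
        exact s _ _ _ _ _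

/-! ### Two-variable Taylor expansion and the ridge property -/

theorem sum_antidiagonal_pow_div_factorial {K : Type*} [Field K] [CharZero K] (x y : K) (n : ℕ) :
    ∑ p ∈ Finset.HasAntidiagonal.antidiagonal n, x ^ p.1 / p.1.factorial * (y ^ p.2 / p.2.factorial)
      = (x + y) ^ n / n.factorial := by
  rw [(Commute.all x y).add_pow', Finset.sum_div]
  refine Finset.sum_congr rfl fun p hp => ?_
  have hp' : p.1 + p.2 = n := Finset.HasAntidiagonal.mem_antidiagonal.1 hp
  have h := Nat.choose_mul_factorial_mul_factorial (show p.1 ≤ n by omega)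
  rw [show n - p.1 = p.2 by omega] at h
  have h1 : (p.1.factorial : K) ≠ 0 := by exact_mod_cast p.1.factorial_ne_zero
  have h2 : (p.2.factorial : K) ≠ 0 := by exact_mod_cast p.2.factorial_ne_zero
  have h3 : (n.factorial : K) ≠ 0 := by exact_mod_cast n.factorial_ne_zero
  have h' : (n.choose p.1 : K) * p.1.factorial * p.2.factorial = n.factorial := by
    exact_mod_cast h
  rw [nsmul_eq_mul]
  field_simp
  rw [← h']
  ring

theorem hasSum_taylor_zero {F : ℂ → ℂ} (hF : Differentiable ℂ F) (z : ℂ) :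
    HasSum (fun n : ℕ => z ^ n / n.factorial * iteratedDeriv n F 0) (F z) := by
  refine (Complex.hasSum_taylorSeries_of_entire hF 0 z).congr_fun fun n => ?_
  simp only [sub_zero, smul_eq_mul]
  ring

theorem hasSum_taylor_add {F : ℂ → ℂ} (hF : Differentiable ℂ F) (z w : ℂ) :
    HasSum (fun p : ℕ × ℕ => z ^ p.1 / p.1.factorial * (w ^ p.2 / p.2.factorial)
      * iteratedDeriv (p.1 + p.2) F 0) (F (z + w)) := by
  rw [← Finset.HasAntidiagonal.sigmaAntidiagonalEquivProd.hasSum_iff]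
  have hfib : ∀ n : ℕ, ∀ p : Finset.HasAntidiagonal.antidiagonal n, p.1.1 + p.1.2 = n := fun n p =>
    Finset.HasAntidiagonal.mem_antidiagonal.1 p.2
  have hfun : ∀ q : Σ n : ℕ, Finset.HasAntidiagonal.antidiagonal n,
      ((fun p : ℕ × ℕ => z ^ p.1 / p.1.factorial * (w ^ p.2 / p.2.factorial)
        * iteratedDeriv (p.1 + p.2) F 0) ∘ Finset.HasAntidiagonal.sigmaAntidiagonalEquivProd) q
      = z ^ q.2.1.1 / q.2.1.1.factorial * (w ^ q.2.1.2 / q.2.1.2.factorial)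
        * iteratedDeriv q.1 F 0 := fun q => by
    simp only [Function.comp, Finset.HasAntidiagonal.sigmaAntidiagonalEquivProd_apply, hfib]
  refine HasSum.sigma_of_hasSum (hasSum_taylor_zero hF (z + w)) (fun n => ?_) ?_
  · rw [← sum_antidiagonal_pow_div_factorial, Finset.sum_mul, ← Finset.sum_coe_sort]
    simp only [hfun]
    exact hasSum_fintype _
  · refine Summable.of_norm ?_
    rw [summable_sigma_of_nonneg fun _ => norm_nonneg _]
    refine ⟨fun n => (hasSum_fintype _).summable, ?_⟩
    -- The norms on each antidiagonal add up, by the binomial theorem, to a norm in the one-variable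
    -- series at the point `‖z‖ + ‖w‖`.
    refine (hasSum_taylor_zero hF ((‖z‖ + ‖w‖ : ℝ) : ℂ)).summable.norm.congr fun n => ?_
    rw [tsum_fintype]
    simp only [hfun, norm_mul, norm_div, norm_pow, Complex.norm_natCast, Complex.norm_real]
    rw [← Finset.sum_mul, Finset.sum_coe_sort (Finset.HasAntidiagonal.antidiagonal n)
      (fun p => ‖z‖ ^ p.1 / p.1.factorial * (‖w‖ ^ p.2 / p.2.factorial)),
      sum_antidiagonal_pow_div_factorial, Real.norm_of_nonneg (by positivity)]

/-- Squares are cofinal among finite sets of pairs, so a sum over `ℕ × ℕ` is the limit of square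
partial sums, which are what the Hankel form controls. -/
theorem tendsto_range_product_range :
    Tendsto (fun N => Finset.range N ×ˢ Finset.range N) atTop atTop := by
  refine tendsto_atTop_finset_of_monotone
    (fun M N h => Finset.product_subset_product (Finset.range_mono h) (Finset.range_mono h))
    fun p => ⟨p.1 + p.2 + 1, ?_⟩
  simp only [Finset.mem_product, Finset.mem_range]
  omega

open scoped ComplexOrder in
/-- An entire function with positive Hankel form extends its positive definiteness to the
complex kernel `F (z - conj w)`. -/
theorem kernel_nonneg_of_hankel_nonneg {F : ℂ → ℂ} (hF : Differentiable ℂ F)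
    (hpos : ∀ (N : ℕ) (a : ℕ → ℂ), 0 ≤ ∑ j ∈ Finset.range N, ∑ k ∈ Finset.range N,
      a j * conj (a k) * ((-1) ^ k * iteratedDeriv (j + k) F 0)) {ι : Type*} (S : Finset ι)
    (c z : ι → ℂ) :
    0 ≤ ∑ p ∈ S, ∑ q ∈ S, c p * conj (c q) * F (z p - conj (z q)) := by
  have hs : HasSum (fun n : ℕ × ℕ => ∑ p ∈ S, ∑ q ∈ S, c p * conj (c q) *
      (z p ^ n.1 / n.1.factorial * ((-conj (z q)) ^ n.2 / n.2.factorial)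
        * iteratedDeriv (n.1 + n.2) F 0))
      (∑ p ∈ S, ∑ q ∈ S, c p * conj (c q) * F (z p - conj (z q))) :=
    hasSum_sum fun p _ => hasSum_sum fun q _ => by
      rw [sub_eq_add_neg]
      exact (hasSum_taylor_add hF _ _).mul_left _
  refine ge_of_tendsto (hs.comp tendsto_range_product_range) (Eventually.of_forall fun N => ?_)
  -- With these coefficients the Hankel form of size `N` is exactly the square partial sum of the
  -- double Taylor series.
  refine (hpos N fun j => ∑ p ∈ S, c p * (z p ^ j / j.factorial)).trans_eq ?_
  simp only [Function.comp]
  rw [Finset.sum_product]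
  refine Finset.sum_congr rfl fun j _ => Finset.sum_congr rfl fun k _ => ?_
  simp only [map_sum, map_mul, map_div₀, map_pow, Complex.conj_natCast]
  rw [Finset.sum_mul_sum, Finset.sum_mul]
  refine Finset.sum_congr rfl fun p _ => ?_
  rw [Finset.sum_mul]
  refine Finset.sum_congr rfl fun q _ => ?_
  rw [neg_pow]
  ring

open scoped ComplexOrder in
/-- The ridge property. -/
theorem norm_le_of_kernel_nonneg {F : ℂ → ℂ}
    (hpos : ∀ c z : Bool → ℂ, 0 ≤ ∑ p, ∑ q, c p * conj (c q) * F (z p - conj (z q))) (x y : ℝ) :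
    ‖F (y + x * Complex.I)‖ ≤ ‖F (x * Complex.I)‖ := by
  set A := F (y + x * Complex.I) with hA
  set B := F (-y + x * Complex.I) with hB
  set M := F (x * Complex.I) with hM
  have key : ∀ c : ℂ, ‖c‖ = 1 → 0 ≤ 2 * M + conj c * A + c * B := fun c hc => by
    -- The points `y + ix/2` and `ix/2` give the argument `ix` on the diagonal of the kernel and `±y
    -- + ix` off it.
    have h := hpos (fun b => if b then 1 else c)
      (fun b => if b then y + x / 2 * Complex.I else x / 2 * Complex.I)
    simp only [Fintype.sum_bool, if_true, Bool.false_eq_true, if_false, map_add, map_mul,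
      Complex.conj_ofReal, Complex.conj_I, map_div₀, map_one, one_mul, mul_one, Complex.conj_ofNat]
      at h
    have hcc : c * conj c = 1 := by rw [Complex.mul_conj, Complex.normSq_eq_norm_sq, hc]; simp
    rw [hcc] at h
    refine h.trans_eq ?_
    have e1 : (y : ℂ) + x / 2 * Complex.I - (y + x / 2 * -Complex.I) = x * Complex.I := by ring
    have e2 : (y : ℂ) + x / 2 * Complex.I - (x / 2 * -Complex.I) = y + x * Complex.I := by ring
    have e3 : (x : ℂ) / 2 * Complex.I - (y + x / 2 * -Complex.I) = -y + x * Complex.I := by ring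
    have e4 : (x : ℂ) / 2 * Complex.I - (x / 2 * -Complex.I) = x * Complex.I := by ring
    rw [e1, e2, e3, e4]
    ring
  -- The imaginary parts for these values of `c` force Hermitian symmetry, `B = conj A`.
  have k1 := (Complex.nonneg_iff.1 (key 1 (by simp)))
  have k2 := (Complex.nonneg_iff.1 (key (-1) (by simp)))
  have k3 := (Complex.nonneg_iff.1 (key Complex.I (by simp)))
  simp at k1 k2 k3
  have hBA : B = conj A := by
    apply Complex.ext
    · simp; linarith [k1.2, k2.2, k3.2]
    · simp; linarith [k1.2, k2.2, k3.2]
  rcases eq_or_ne A 0 with h0 | h0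
  · rw [h0, norm_zero]; exact norm_nonneg _
  have hn : (‖A‖ : ℂ) ≠ 0 := by simpa using h0
  -- This phase makes the two cross terms add up to `-2‖A‖`.
  have k4 := (Complex.nonneg_iff.1 (key (-A / ‖A‖) (by
    rw [norm_div, norm_neg, Complex.norm_real, norm_norm, div_self (by simpa using h0)]))).1
  have e : 2 * M + conj (-A / ‖A‖) * A + (-A / ‖A‖) * B = 2 * M - ((2 * ‖A‖ : ℝ) : ℂ) := by
    rw [hBA, map_div₀, map_neg, Complex.conj_ofReal]
    have : conj A * A = ‖A‖ * ‖A‖ := by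
      rw [mul_comm, Complex.mul_conj, Complex.normSq_eq_norm_sq]; push_cast; ring
    field_simp
    push_cast
    linear_combination -2 * this
  rw [e] at k4
  simp only [Complex.sub_re, Complex.ofReal_re, Complex.mul_re, Complex.re_ofNat, Complex.im_ofNat,
    zero_mul, sub_zero] at k4
  have := Complex.re_le_norm M
  linarith

open scoped ComplexOrder in
theorem norm_le_of_posDef_near_zero {F : ℂ → ℂ} (hF : Differentiable ℂ F) {δ : ℝ} (hδ : 0 < δ)
    (hpos : ∀ (N : ℕ) (c : ℕ → ℂ) (t : ℕ → ℝ), (∀ l < N, |t l| < δ) →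
      0 ≤ ∑ l ∈ Finset.range N, ∑ m ∈ Finset.range N,
        c l * conj (c m) * F (t l - t m)) (x y : ℝ) :
    ‖F (y + x * Complex.I)‖ ≤ ‖F (x * Complex.I)‖ :=
  norm_le_of_kernel_nonneg
    (kernel_nonneg_of_hankel_nonneg hF (hankel_nonneg hF hδ hpos) Finset.univ) x y

/-! ### Exponentials of polynomials with the ridge property -/

theorem tendsto_sum_mul_pow_div_pow (a : ℕ → ℂ) (d : ℕ) (z : ℂ) :
    Tendsto (fun r : ℝ => (∑ k ∈ Finset.range (d + 1), a k * (r * z) ^ k) / (r : ℂ) ^ d) atTop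
      (𝓝 (a d * z ^ d)) := by
  have hlow : Tendsto (fun r : ℝ => ∑ k ∈ Finset.range d, a k * z ^ k * ((r : ℂ) ^ k / (r : ℂ) ^ d))
      atTop (𝓝 (∑ k ∈ Finset.range d, a k * z ^ k * 0)) := by
    refine tendsto_finsetSum _ fun k hk => Tendsto.const_mul _ ?_
    have h := (Complex.continuous_ofReal.tendsto 0).comp
      (tendsto_pow_div_pow_atTop_zero (𝕜 := ℝ) (Finset.mem_range.1 hk))
    simpa [Function.comp_def] using h
  have h := hlow.add_const (a d * z ^ d)
  simp only [mul_zero, Finset.sum_const_zero, zero_add] at h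
  refine h.congr' ?_
  filter_upwards [eventually_gt_atTop 0] with r hr
  have h0 : (r : ℂ) ≠ 0 := by exact_mod_cast hr.ne'
  rw [Finset.sum_range_succ, add_div, Finset.sum_div]
  congr 1
  · refine Finset.sum_congr rfl fun k _ => ?_
    rw [mul_pow]; ring
  · rw [mul_pow]; field_simp

/-- A polynomial `q` of degree `d ≥ 3` does not satisfy `Re q(y + ix) ≤ Re q(ix)` for all real
`x` and `y`. -/
theorem not_re_le_of_three_le_degree (a : ℕ → ℂ) {d : ℕ} (hd : 2 < d) (ha : a d ≠ 0)
    (hridge : ∀ x y : ℝ, (∑ k ∈ Finset.range (d + 1), a k * (y + x * Complex.I) ^ k).re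
      ≤ (∑ k ∈ Finset.range (d + 1), a k * (x * Complex.I) ^ k).re) : False := by
  have hd0 : d ≠ 0 := by omega
  -- Put `r * w` into the inequality, divide by `r ^ d` and let `r → ∞`: only the leading terms
  -- survive.
  have hlim : ∀ w : ℂ, (a d * w ^ d).re ≤ (a d * (w.im * Complex.I) ^ d).re := fun w => by
    refine le_of_tendsto_of_tendsto
      ((Complex.continuous_re.tendsto _).comp (tendsto_sum_mul_pow_div_pow a d w))
      ((Complex.continuous_re.tendsto _).comp
        (tendsto_sum_mul_pow_div_pow a d (w.im * Complex.I))) ?_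
    filter_upwards [eventually_gt_atTop 0] with r hr
    have h := hridge (r * w.im) (r * w.re)
    simp only [Function.comp]
    rw [← Complex.ofReal_pow, Complex.div_ofReal_re, Complex.div_ofReal_re]
    have e1 : ((r * w.re : ℝ) : ℂ) + (r * w.im : ℝ) * Complex.I = r * w := by
      conv_rhs => rw [← Complex.re_add_im w]
      push_cast; ring
    have e2 : ((r * w.im : ℝ) : ℂ) * Complex.I = r * (w.im * Complex.I) := by push_cast; ring
    rw [e1, e2] at h
    gcongr
  -- For such `w` the left side of `hlim` attains `‖a d‖`, while the right side is at most `‖a d‖ *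
  -- |Im w| ^ d`. As `‖w‖ = 1`, this leaves only `w = ±i`.
  have hroot : ∀ w : ℂ, w ^ d = ‖a d‖ / a d → w ^ 2 = -1 := fun w hw => by
    have hnw : ‖w‖ = 1 := by
      refine (pow_eq_one_iff_of_nonneg (norm_nonneg w) hd0).1 ?_
      rw [← norm_pow, hw, norm_div, Complex.norm_real, norm_norm, div_self (by simpa using ha)]
    have h := hlim w
    rw [hw, mul_div_cancel₀ _ ha, Complex.ofReal_re] at h
    have h2 := h.trans (Complex.re_le_norm _)
    rw [norm_mul, norm_pow, norm_mul, Complex.norm_I, mul_one, Complex.norm_real,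
      le_mul_iff_one_le_right (by simpa using ha)] at h2
    have h3 : 1 ≤ ‖w.im‖ := by
      by_contra hlt
      exact absurd h2 (not_le.2 (pow_lt_one₀ (norm_nonneg _) (not_le.1 hlt) hd0))
    have h4 : w.re ^ 2 + w.im ^ 2 = 1 := by
      have := Complex.sq_norm w
      rw [hnw, Complex.normSq_apply] at this
      linarith
    have h5 : 1 ≤ w.im ^ 2 := by
      rw [← sq_abs, ← Real.norm_eq_abs]; exact one_le_pow₀ h3
    have h6 : w.re = 0 := by nlinarith [sq_nonneg w.re]
    have h7 : w.im ^ 2 = 1 := by rw [h6] at h4; linarith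
    rw [← Complex.re_add_im w, h6]
    simp only [Complex.ofReal_zero, zero_add, mul_pow, Complex.I_sq]
    rw [← Complex.ofReal_pow, h7]; simp
  -- The equation has `d > 2` roots, too many for `±i`: the ratio `ζ` of two of them is a primitive
  -- `d`-th root of unity with `ζ ^ 2 = 1`, so `d ∣ 2`.
  obtain ⟨w, hw⟩ := IsAlgClosed.exists_pow_nat_eq (‖a d‖ / a d) (Nat.pos_of_ne_zero hd0)
  have hζ := Complex.isPrimitiveRoot_exp d hd0
  set ζ := Complex.exp (2 * Real.pi * Complex.I / d)
  have h1 := hroot w hw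
  have h2 := hroot (w * ζ) (by rw [mul_pow, hζ.pow_eq_one, mul_one, hw])
  rw [mul_pow, h1] at h2
  have h3 : ζ ^ 2 = 1 := by linear_combination -h2
  have := Nat.le_of_dvd (by norm_num) (hζ.dvd_of_pow_eq_one 2 h3)
  omega

/-- On a line through the origin, the coefficient of `t ^ k` is the value of the degree-`k` part at
the direction vector, so a direction where the top part is nonzero preserves the degree. -/
theorem eval_mul_eq_sum_homogeneousComponent {σ : Type*} (P : MvPolynomial σ ℂ) (v : σ → ℂ)
    (t : ℂ) : MvPolynomial.eval (fun i => t * v i) P = ∑ k ∈ Finset.range (P.totalDegree + 1),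
      MvPolynomial.eval v (MvPolynomial.homogeneousComponent k P) * t ^ k := by
  conv_lhs => rw [← P.sum_homogeneousComponent]
  rw [map_sum]
  refine Finset.sum_congr rfl fun k _ => ?_
  have hk := MvPolynomial.homogeneousComponent_isHomogeneous k P
  rw [MvPolynomial.eval_eq, MvPolynomial.eval_eq, Finset.sum_mul]
  refine Finset.sum_congr rfl fun m hm => ?_
  have hdeg : ∑ i ∈ m.support, m i = k := by
    have h : Finsupp.weight (fun _ => 1) m = k := hk (MvPolynomial.mem_support_iff.1 hm)
    rwa [← Finsupp.degree_eq_weight_one, Finsupp.degree_apply] at h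
  simp only [mul_pow]
  rw [Finset.prod_mul_distrib, Finset.prod_pow_eq_pow_sum, hdeg]
  ring

theorem homogeneousComponent_totalDegree_ne_zero {σ R : Type*} [CommSemiring R]
    {P : MvPolynomial σ R} (hP : P ≠ 0) :
    MvPolynomial.homogeneousComponent P.totalDegree P ≠ 0 := by
  intro h
  obtain ⟨m, hm, hmd⟩ := Finset.exists_mem_eq_sup P.support
    (by simpa [Finset.nonempty_iff_ne_empty] using hP) (fun s => s.sum fun _ e => e)
  have hc := MvPolynomial.coeff_homogeneousComponent P.totalDegree P m
  rw [h, MvPolynomial.coeff_zero, if_pos (show m.degree = P.totalDegree from hmd.symm)] at hc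
  exact MvPolynomial.mem_support_iff.1 hm hc.symm

/-- The phase-space variables are real while the coefficients are complex; real points suffice
because `ℝ` is infinite. -/
theorem exists_real_eval_ne_zero {σ : Type*} {Q : MvPolynomial σ ℂ} (hQ : Q ≠ 0) :
    ∃ v : σ → ℝ, MvPolynomial.eval (fun i => (v i : ℂ)) Q ≠ 0 := by
  by_contra! h
  refine hQ (MvPolynomial.funext_set (fun _ => Set.range ((↑) : ℝ → ℂ))
    (fun _ => Set.infinite_range_of_injective Complex.ofReal_injective) fun x hx => ?_)
  choose v hv using fun i => hx i (Set.mem_univ i)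
  rw [map_zero, ← h v]
  congr 2
  funext i
  exact (hv i).symm

/-! ### Positive definiteness of the trace along a one-parameter group -/

theorem HilbertBasis.hasSum_norm_inner_sq {ι E : Type*} [NormedAddCommGroup E]
    [InnerProductSpace ℂ E] (b : HilbertBasis ι ℂ E) (x : E) :
    HasSum (fun i => ‖⟪x, b i⟫_ℂ‖ ^ 2) (‖x‖ ^ 2) := by
  have h := b.hasSum_inner_mul_inner x x
  rw [inner_self_eq_norm_sq_to_K] at h
  have e : (fun i => ⟪x, b i⟫_ℂ * ⟪b i, x⟫_ℂ) = fun i => ((‖⟪x, b i⟫_ℂ‖ ^ 2 : ℝ) : ℂ) := by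
    funext i
    rw [← inner_conj_symm (b i) x, Complex.mul_conj, Complex.normSq_eq_norm_sq]
  rw [e] at h
  refine Complex.hasSum_ofReal.1 ?_
  rw [Complex.ofReal_pow]
  exact h

theorem summable_norm_inner_sq_prod {ι E : Type*} [NormedAddCommGroup E]
    [InnerProductSpace ℂ E] (b : HilbertBasis ι ℂ E) {x : ι → E}
    (hx : Summable fun i => ‖x i‖ ^ 2) :
    Summable fun p : ι × ι => ‖⟪x p.1, b p.2⟫_ℂ‖ ^ 2 := by
  rw [summable_prod_of_nonneg fun _ => by positivity]
  exact ⟨fun i => (b.hasSum_norm_inner_sq (x i)).summable,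
    hx.congr fun i => (b.hasSum_norm_inner_sq (x i)).tsum_eq.symm⟩

/-- Cyclicity of the trace: `Tr(R² T) = Tr(R T R)` for a self-adjoint Hilbert–Schmidt `R`. -/
theorem hasSum_inner_operatorTrace {ι E : Type*} [NormedAddCommGroup E]
    [InnerProductSpace ℂ E] [CompleteSpace E] (b : HilbertBasis ι ℂ E) {R : E →L[ℂ] E}
    (hR : IsSelfAdjoint R) (hsum : Summable fun i => ‖R (b i)‖ ^ 2) (T : E →L[ℂ] E) :
    HasSum (fun i => ⟪R (b i), T (R (b i))⟫_ℂ) (operatorTrace b ((R * R) ∘L T)) := by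
  have hsym : ∀ x y, ⟪R x, y⟫_ℂ = ⟪x, R y⟫_ℂ := hR.isSymmetric
  set T' := ContinuousLinearMap.adjoint T with hT'
  have hsum' : Summable fun j => ‖T' (R (b j))‖ ^ 2 := by
    refine Summable.of_nonneg_of_le (fun _ => by positivity) (fun j => ?_)
      (hsum.mul_left (‖T'‖ ^ 2))
    rw [← mul_pow]
    exact pow_le_pow_left₀ (norm_nonneg _) (T'.le_opNorm _) 2
  -- By Parseval, the row sums of `u` are the diagonal entries of `R²T` and the column sums those of
  -- `RTR`. Both factors are square summable over pairs, so `u` is absolutely summable and the sums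
  -- may be exchanged.
  set u : ι → ι → ℂ := fun i j => ⟪R (b i), b j⟫_ℂ * ⟪T' (R (b j)), b i⟫_ℂ with hu
  have hus : Summable (Function.uncurry u) := by
    refine Summable.of_norm_bounded ((summable_norm_inner_sq_prod b hsum).add
      ((Equiv.prodComm ι ι).summable_iff.2 (summable_norm_inner_sq_prod b hsum'))) fun p => ?_
    simp only [Function.uncurry, hu, norm_mul, Function.comp, Equiv.prodComm_apply,
      Prod.fst_swap, Prod.snd_swap]
    nlinarith [sq_nonneg (‖⟪R (b p.1), b p.2⟫_ℂ‖ - ‖⟪T' (R (b p.2)), b p.1⟫_ℂ‖),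
      sq_nonneg (‖⟪R (b p.1), b p.2⟫_ℂ‖ + ‖⟪T' (R (b p.2)), b p.1⟫_ℂ‖)]
  have hrow : ∀ i, ∑' j, u i j = ⟪b i, ((R * R) ∘L T) (b i)⟫_ℂ := fun i => by
    have h := b.tsum_inner_mul_inner (R (b i)) (R (T (b i)))
    rw [hsym (b i)] at h
    refine Eq.trans (tsum_congr fun j => ?_) h
    simp only [hu]
    rw [← hsym, hT', ContinuousLinearMap.adjoint_inner_left]
  have hcol : ∀ j, ∑' i, u i j = ⟪R (b j), T (R (b j))⟫_ℂ := fun j => by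
    have h := b.tsum_inner_mul_inner (T' (R (b j))) (R (b j))
    rw [hT', ContinuousLinearMap.adjoint_inner_left] at h
    refine Eq.trans (tsum_congr fun i => ?_) h
    simp only [hu]
    rw [hsym, mul_comm]
  have hs : Summable fun i => ⟪R (b i), T (R (b i))⟫_ℂ := by
    refine Summable.of_norm_bounded (hsum.mul_left ‖T‖) fun i => ?_
    refine (norm_inner_le_norm _ _).trans ?_
    nlinarith [T.le_opNorm (R (b i)), norm_nonneg (R (b i))]
  have htr : operatorTrace b ((R * R) ∘L T) = ∑' i, ⟪R (b i), T (R (b i))⟫_ℂ := by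
    unfold operatorTrace
    rw [← tsum_congr hrow, ← tsum_congr hcol]
    exact hus.tsum_comm.symm
  rw [htr]
  exact hs.hasSum

open scoped ComplexOrder in
/-- `t ↦ Tr(ρ U(t))` is positive definite for a density operator `ρ` and a one-parameter group
`U` of isometries. -/
theorem operatorTrace_posDef {ι E : Type*} [NormedAddCommGroup E] [InnerProductSpace ℂ E]
    [CompleteSpace E] (b : HilbertBasis ι ℂ E) {ρ : E →L[ℂ] E} (hρ : IsDensityOperator b ρ)
    (U : ℝ → E →ₗᵢ[ℂ] E) (hU : ∀ s t x, U (s + t) x = U s (U t x))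
    (N : ℕ) (c : ℕ → ℂ) (t : ℕ → ℝ) :
    0 ≤ ∑ l ∈ Finset.range N, ∑ m ∈ Finset.range N,
      c l * conj (c m) * operatorTrace b (ρ ∘L (U (t l - t m)).toContinuousLinearMap) := by
  have hρ0 : 0 ≤ ρ := (ContinuousLinearMap.nonneg_iff_isPositive ρ).2 hρ.isPositive
  -- The root is Hilbert–Schmidt, since the sum of `‖R (b i)‖ ^ 2` is the trace of `ρ`. Cyclicity
  -- then writes the trace as a sum of expectations of `U` in the vectors `R (b i)`.
  set R := CFC.sqrt ρ with hRdef
  have hRR : R * R = ρ := CFC.sqrt_mul_sqrt_self ρ hρ0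
  have hR : IsSelfAdjoint R := (CFC.sqrt_nonneg ρ).isSelfAdjoint
  have hsum : Summable fun i => ‖R (b i)‖ ^ 2 := by
    rw [← Complex.summable_ofReal]
    refine hρ.summable.congr fun i => ?_
    have hsym : ⟪R (b i), R (b i)⟫_ℂ = ⟪b i, R (R (b i))⟫_ℂ := hR.isSymmetric _ _
    rw [← hRR, mul_apply_eq_comp, ← hsym, inner_self_eq_norm_sq_to_K]
    push_cast; rfl
  have h := hasSum_sum (s := Finset.range N) fun l _ => hasSum_sum (s := Finset.range N)
    fun m _ => (hasSum_inner_operatorTrace b hR hsum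
      (U (t l - t m)).toContinuousLinearMap).mul_left (c l * conj (c m))
  rw [hRR] at h
  refine h.nonneg fun i => ?_
  -- Applying the isometry `U (t m)` to both sides of the inner product yields a Gram matrix,
  -- without inverting any `U t`.
  have e : ∀ l m, ⟪R (b i), U (t l - t m) (R (b i))⟫_ℂ
      = ⟪U (t m) (R (b i)), U (t l) (R (b i))⟫_ℂ := fun l m => by
    rw [← (U (t m)).inner_map_map, ← hU, add_sub_cancel]
  have e2 : ∑ l ∈ Finset.range N, ∑ m ∈ Finset.range N,
      c l * conj (c m) * ⟪R (b i), (U (t l - t m)).toContinuousLinearMap (R (b i))⟫_ℂ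
      = ⟪∑ m ∈ Finset.range N, c m • U (t m) (R (b i)),
          ∑ l ∈ Finset.range N, c l • U (t l) (R (b i))⟫_ℂ := by
    rw [inner_sum]
    refine Finset.sum_congr rfl fun l _ => ?_
    rw [sum_inner]
    refine Finset.sum_congr rfl fun m _ => ?_
    rw [inner_smul_left, inner_smul_right, LinearIsometry.coe_toContinuousLinearMap, e]
    ring
  rw [e2, inner_self_eq_norm_sq_to_K]
  have hsq : ∀ r : ℝ, 0 ≤ r → (0 : ℂ) ≤ (r : ℂ) ^ 2 := fun r hr =>
    pow_nonneg (Complex.zero_le_real.2 hr) 2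
  exact hsq ‖_‖ (norm_nonneg _)

/-! ### Displacements along a line and the main theorem -/

/-- Displacements compose in general only up to a symplectic phase; it vanishes for two multiples of
the same `ξ`. -/
theorem displaceFun_add_smul {n : ℕ} (ξ : Fin n → ℂ) (s t : ℝ) (ψ : (Fin n → ℝ) → ℂ) :
    displaceFun ((s + t) • ξ) ψ = displaceFun (s • ξ) (displaceFun (t • ξ) ψ) := by
  have hs : ∀ r : ℝ, positionShift (r • ξ) = r • positionShift ξ := fun r => by
    funext j; simp [positionShift]; ring
  have hm : ∀ (r : ℝ) j, momentumShift (r • ξ) j = r * momentumShift ξ j := fun r j => by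
    simp [momentumShift]; ring
  funext x
  simp only [displaceFun, displacementPhase, hs, hm, ← mul_assoc, ← Complex.exp_add]
  congr 2
  · rw [← add_mul, ← Complex.ofReal_add, ← Finset.sum_add_distrib]
    congr 3
    funext j
    simp only [Pi.smul_apply, Pi.sub_apply, smul_eq_mul]
    ring
  · rw [add_smul, sub_sub]

theorem displacementIsometry_ae_eq {n : ℕ} (ξ : Fin n → ℂ) (ψ : ModeSpace n) :
    displacementIsometry ξ ψ =ᵐ[volume] displaceFun ξ ψ :=
  MemLp.coeFn_toLp (memLp_displaceFun ξ (Lp.memLp ψ))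

theorem displacementIsometry_add_smul {n : ℕ} (ξ : Fin n → ℂ) (s t : ℝ) (ψ : ModeSpace n) :
    displacementIsometry ((s + t) • ξ) ψ
      = displacementIsometry (s • ξ) (displacementIsometry (t • ξ) ψ) := by
  refine Lp.ext ?_
  have h := displaceFun_congr (s • ξ) (displacementIsometry_ae_eq (t • ξ) ψ)
  refine (displacementIsometry_ae_eq _ _).trans ?_
  rw [displaceFun_add_smul]
  exact h.symm.trans (displacementIsometry_ae_eq _ _).symm

/-- The cumulant generating function of an `s`-ordered quasi-probability of an `n`-mode state is
not a polynomial of degree greater than two, on any neighbourhood `U` of the origin (in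
particular not on the whole of `ℂⁿ`). -/
theorem theorem4 (n : ℕ) {ι : Type*} (b : HilbertBasis ι ℂ (ModeSpace n))
    (ρ : ModeSpace n →L[ℂ] ModeSpace n) (hρ : IsDensityOperator b ρ)
    (s : ℝ) (hs : s ∈ Set.Icc (-1 : ℝ) 1) :
    ¬ ∃ P : MvPolynomial (Fin n ⊕ Fin n) ℂ, 2 < P.totalDegree ∧
      ∃ U ∈ 𝓝 (0 : Fin n → ℂ),
        IsCumulantGeneratingFunctionOn U (quasiCharFun b ρ s) (phasePolynomial P) := by
  rintro ⟨P, hdeg, U, hU, hP⟩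
  have hP0 : P ≠ 0 := by
    rintro rfl
    simp at hdeg
  obtain ⟨v, hv⟩ := exists_real_eval_ne_zero (homogeneousComponent_totalDegree_ne_zero hP0)
  set d := P.totalDegree
  set ξ : Fin n → ℂ := fun j => v (Sum.inl j) + v (Sum.inr j) * Complex.I with hξ
  set S : ℝ := s / 2 * ∑ j, ‖ξ j‖ ^ 2 with hS
  -- Coefficients of `P` along the line, with the exponent of the `s`-ordering factor removed from
  -- the quadratic one; the coefficient of degree `d > 2` is untouched.
  set a : ℕ → ℂ := fun k => MvPolynomial.eval (fun i => (v i : ℂ))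
    (MvPolynomial.homogeneousComponent k P) - if k = 2 then (S : ℂ) else 0 with ha
  set p : ℂ → ℂ := fun z => ∑ k ∈ Finset.range (d + 1), a k * z ^ k with hp
  have hpS : ∀ t : ℝ, p t = phasePolynomial P (t • ξ) - (t ^ 2 * S : ℝ) := fun t => by
    have e : phasePolynomial P (t • ξ)
        = MvPolynomial.eval (fun i => (t : ℂ) * (v i : ℂ)) P := by
      unfold phasePolynomial
      congr 2
      funext i
      cases i <;> simp [hξ]
    rw [e, eval_mul_eq_sum_homogeneousComponent]
    simp only [hp, ha, sub_mul, Finset.sum_sub_distrib, ite_mul, zero_mul]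
    rw [Finset.sum_ite_eq' (Finset.range (d + 1)) 2 fun k => (S : ℂ) * (t : ℂ) ^ k,
      if_pos (by simp; omega)]
    push_cast; ring
  obtain ⟨δ, hδ, hδU⟩ : ∃ δ > 0, ∀ t : ℝ, |t| < δ → t • ξ ∈ U := by
    have hc : Tendsto (fun t : ℝ => t • ξ) (𝓝 0) (𝓝 0) := by
      have : Continuous fun t : ℝ => t • ξ := by fun_prop
      simpa using this.tendsto 0
    obtain ⟨δ, hδ, h⟩ := Metric.mem_nhds_iff.1 (hc hU)
    exact ⟨δ, hδ, fun t ht => h (by simpa using ht)⟩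
  have htr : ∀ t : ℝ, |t| < δ → operatorTrace b (ρ ∘L displacement (t • ξ)) = Complex.exp (p t) :=
    fun t ht => by
      have h := hP _ (hδU t ht)
      have hn : s / 2 * ∑ j, ‖(t • ξ) j‖ ^ 2 = t ^ 2 * S := by
        simp only [hS, Pi.smul_apply, norm_smul, mul_pow, ← Finset.mul_sum, Real.norm_eq_abs,
          sq_abs]
        ring
      rw [quasiCharFun, hn] at h
      rw [hpS, Complex.exp_sub, h, mul_div_cancel_left₀ _ (Complex.exp_ne_zero _)]
  have hF : Differentiable ℂ fun z => Complex.exp (p z) := by fun_prop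
  -- The radius is halved because the trace formula is needed at the differences `t l - t m`.
  have hridge := norm_le_of_posDef_near_zero hF (half_pos hδ) fun N c t ht => by
    have h := operatorTrace_posDef b hρ (fun t => displacementIsometry (t • ξ))
      (displacementIsometry_add_smul ξ) N c t
    convert h using 5 with l hl m hm
    have h1 := ht l (Finset.mem_range.1 hl)
    have h2 := ht m (Finset.mem_range.1 hm)
    have h := htr (t l - t m) ((abs_sub _ _).trans_lt (by linarith))
    rw [Complex.ofReal_sub] at h
    exact h.symm
  refine not_re_le_of_three_le_degree a hdeg ?_ fun x y => ?_
  · simp only [ha]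
    rwa [if_neg (by omega), sub_zero]
  · have h := hridge x y
    rwa [Complex.norm_exp, Complex.norm_exp, Real.exp_le_exp] at h
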